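/- For $n\ge 0$ let $IP_n:\{0,1\}^{2n}\to\{0,1\}$ be the mod 2 inner product function $$IP_n(x_1,\dots,x_n,y_1,\dots,y_n)=(x_1\wedge y_1)\oplus\cdots\oplus(x_n\wedge y_n).$$ For $k\ge 1$, a $k$-nearest neighbor representation of a Boolean function $f:\{0,1\}^N\to\{0,1\}$ is a pair $(P,Q)$ of disjoint finite subsets of $\mathbb R^N$ such that for every $a\in\{0,1\}^N$ the following holds: there is a (necessarily unique) set $S\subseteq P\cup Q$ of exactly $k$ points whose Euclidean distances from $a$ are all strictly smaller than the distances from $a$ of all points of $(P\cup Q)\setminus S$, and $f(a)=1$ if and only if at least $k/2$ of the points of $S$ belong to $P$. The $k$-nearest neighbor complexity $k\text{-}NN(f)$ is the minimum of $|P\cup Q|$ over all $k$-nearest neighbor representations $(P,Q)$ of $f$. Theorem. For every $k\ge 1$, $$k\text{-}NN(IP_n)\ \ge\ \frac{n}{6+o(1)}\qquad(n\to\infty),$$ where the $o(1)$ term does not depend on $k$. That is, there is a function $\varepsilon:\mathbb N\to[0,\infty)$ with $\varepsilon(n)\to 0$ as $n\to\infty$ such that for all $k\ge 1$ and all $n$,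 $k\text{-}NN(IP_n)\ge n/(6+\varepsilon(n))$. (For $n=0$, where a representation need not exist, the bound is trivial: take $k\text{-}NN(IP_0)=0$ if there is none.) -/

import Mathlib

open Filter Topology

/-- The vertex of the Boolean cube `{0,1}^ι`, seen as a point of the Euclidean space `ℝ^ι`. -/
noncomputable def cubePoint {ι : Type*} (a : ι → Bool) : EuclideanSpace ℝ ι :=
  WithLp.toLp 2 (fun i => if a i = true then (1 : ℝ) else 0)

/-- `S` is the set of the `k` prototypes in `Q` closest to `a`: it has `k` elements, and the
distances from `a` to its points are all strictly smaller than the distances from `a` to the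
remaining points of `Q`. -/
def IsKNearest {E : Type*} [MetricSpace E] (k : ℕ) (Q : Finset E) (a : E) (S : Finset E) : Prop :=
  S ⊆ Q ∧ S.card = k ∧ ∀ p ∈ S, ∀ q ∈ Q, q ∉ S → dist a p < dist a q

open Classical in
/-- `(P, N)` is a `k`-nearest neighbor representation of the Boolean function `f`: `P` and `N` are
disjoint, and for every vertex `a` of the cube the `k` closest prototypes are well defined
(no tie at the boundary) and `f a = 1` iff at least `k / 2` of them belong to `P`. -/
def IsKNNRepresentation {ι : Type*} [Fintype ι] (k : ℕ) (f : (ι → Bool) → Bool)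
    (P N : Finset (EuclideanSpace ℝ ι)) : Prop :=
  Disjoint P N ∧
    ∀ a : ι → Bool, ∃ S : Finset (EuclideanSpace ℝ ι),
      IsKNearest k (P ∪ N) (cubePoint a) S ∧
        (f a = true ↔ (k : ℝ) / 2 ≤ ((S ∩ P).card : ℝ))

open Classical in
/-- The `k`-nearest neighbor complexity: the minimum of the sizes `|P ∪ N|` of the `k`-nearest
neighbor representations of `f`. (It would be `0` if there were none; so a positive lower bound
on it includes the existence of a representation.) -/
noncomputable def kNNComplexity {ι : Type*} [Fintype ι] (k : ℕ) (f : (ι → Bool) → Bool) : ℕ :=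
  sInf {m : ℕ | ∃ P N : Finset (EuclideanSpace ℝ ι),
    IsKNNRepresentation k f P N ∧ (P ∪ N).card = m}

/-- The mod 2 inner product `(x₁ ∧ y₁) ⊕ ⋯ ⊕ (xₙ ∧ yₙ)` of `2n` variables; the variable `xᵢ` is
indexed by `Sum.inl i` and `yᵢ` by `Sum.inr i`. -/
def innerProductMod2 (n : ℕ) (z : Fin n ⊕ Fin n → Bool) : Bool :=
  (List.ofFn fun i : Fin n => z (Sum.inl i) && z (Sum.inr i)).foldr xor false

/-!
The argument bounds the sign rank of the `2 ^ n × 2 ^ n` sign matrix of `innerProductMod2 n` from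
above by means of a nearest neighbor representation, and from below by Forster's method.

*Upper bound.* The squared distance of a vertex `(x, y)` to a prototype is a function of `x` plus a
function of `y`. The `k` nearest prototypes form the unique minimizer of `∑ p ∈ T, dist a p ^ 2`
over the `k`-element sets `T` of prototypes (`IsKNearest.sum_dist_sq_lt`). For large `β` the sum
`∑ T, ± exp (-β * ∑ p ∈ T, dist a p ^ 2)`, where the sign of `T` is its majority vote, therefore has
the sign prescribed by the function, and each of its terms is a product of a function of `x` and a
function of `y`. With `m` prototypes the sign rank is thus at most `m.choose k ≤ 2 ^ m`
(`IsKNNRepresentation.exists_sign_representation`).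

*Lower bound.* If vectors `φ x`, `ψ y` in dimension `d` represent the signs of a Hadamard matrix of
size `N`, then `N ≤ 16 * d ^ 2` (`card_le_of_sign_representation`). After a suitable linear change of
coordinates the normalized vectors `φ x` have second moment at least a constant times `N / d` in
each direction; so the normalized inner products, all of the sign of the matrix, have a large sum
against the matrix, while Lindsey's lemma (`sq_sum_mul_inner_le`) bounds that sum from above.

For the change of coordinates (`exists_linearEquiv_nearly_isotropic`) each `φ x` is replaced by the
`d` vectors `φ x + δ eⱼ`, which form a basis for small `δ ≠ 0`. Hadamard's inequality, applied to
each of these bases, bounds from below the potential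
`∑ x, ∑ j, log (‖B (v x j)‖ ^ 2) - N * log (det B ^ 2)` over all invertible `B`. At a `B` where it is
close to its infimum, no direction can have a small second moment, since stretching that direction
by the factor `2` would lower the potential too far. No minimizer is needed.

Together `2 ^ n ≤ 16 * 4 ^ m`, that is `n ≤ 2 * m + 4 ≤ 6 * m`. As the complexity is an infimum of
natural numbers, `exists_isKNNRepresentation` is needed to know that the infimum is attained.
-/

/-! ### Hadamard's inequality and nearly isotropic position -/

/-- Hadamard's inequality for the determinant in an orthonormal basis with any index type. -/
theorem OrthonormalBasis.abs_det_le_prod_norm {ι E : Type*} [Fintype ι] [DecidableEq ι]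
    [NormedAddCommGroup E] [InnerProductSpace ℝ E] (b : OrthonormalBasis ι ℝ E) (v : ι → E) :
    |b.toBasis.det v| ≤ ∏ i, ‖v i‖ := by
  let e := Fintype.equivFin ι
  let b' := b.reindex e
  have : Fact (Module.finrank ℝ E = Fintype.card ι) :=
    ⟨Module.finrank_eq_card_basis b.toBasis⟩
  have h1 := b'.toBasis.orientation.abs_volumeForm_apply_le (v ∘ e.symm)
  rw [b'.toBasis.orientation.volumeForm_robust b' rfl] at h1
  have h2 : b'.toBasis.det (v ∘ e.symm) = b.toBasis.det v := by
    rw [OrthonormalBasis.reindex_toBasis, Module.Basis.det_reindex]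
    congr 1
    ext i
    simp
  rw [h2] at h1
  exact h1.trans_eq (e.symm.prod_comp fun i => ‖v i‖)

theorem inner_div_norm_sq_le_one {E : Type*} [NormedAddCommGroup E] [InnerProductSpace ℝ E]
    (w : E) {u : E} (hu : ‖u‖ = 1) : (inner ℝ w u / ‖w‖) ^ 2 ≤ 1 := by
  rw [div_pow, ← sq_abs]
  refine div_le_one_of_le₀ ?_ (sq_nonneg _)
  have := abs_real_inner_le_norm w u
  rw [hu, mul_one] at this
  gcongr

/-- The map `w ↦ w + ⟪u, w⟫ u` stretches the unit direction `u` by the factor `2`; it increases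
`log (‖w‖ ^ 2)` by at most three times the squared cosine of the angle between `w` and `u`. -/
theorem log_norm_sq_stretch_le {E : Type*} [NormedAddCommGroup E] [InnerProductSpace ℝ E]
    {w u : E} (hw : w ≠ 0) (hu : ‖u‖ = 1) :
    Real.log (‖w + inner ℝ u w • u‖ ^ 2) ≤
      Real.log (‖w‖ ^ 2) + 3 * (inner ℝ w u / ‖w‖) ^ 2 := by
  have hw' : 0 < ‖w‖ := norm_pos_iff.2 hw
  have h1 : ‖w + inner ℝ u w • u‖ ^ 2 =
      ‖w‖ ^ 2 * (1 + 3 * (inner ℝ w u / ‖w‖) ^ 2) := by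
    rw [norm_add_sq_real, norm_smul, hu, inner_smul_right, real_inner_comm, mul_one,
      Real.norm_eq_abs, sq_abs]
    field_simp
    ring
  have h2 : 0 < 1 + 3 * (inner ℝ w u / ‖w‖) ^ 2 := by positivity
  rw [h1, Real.log_mul (by positivity) h2.ne']
  have := Real.log_le_sub_one_of_pos h2
  linarith

/-- Forster's theorem on nearly isotropic position, for a family of bases: after a suitable linear
change of coordinates, the normalized vectors of the family have in every direction a second moment
of at least a quarter of its average over all directions, which is `Fintype.card X`. -/
theorem exists_linearEquiv_nearly_isotropic {X ι E : Type*} [Fintype X] [Fintype ι]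
    [DecidableEq ι] [NormedAddCommGroup E] [InnerProductSpace ℝ E] (b : OrthonormalBasis ι ℝ E)
    (v : X → ι → E) (hv : ∀ x, b.toBasis.det (v x) ≠ 0) :
    ∃ B : E ≃ₗ[ℝ] E, ∀ u : E, ‖u‖ = 1 →
      (Fintype.card X : ℝ) / 4 ≤ ∑ x, ∑ j, (inner ℝ (B (v x j)) u / ‖B (v x j)‖) ^ 2 := by
  classical
  rcases isEmpty_or_nonempty X with hX | hX
  · exact ⟨LinearEquiv.refl ℝ E, fun u _ => by simp⟩
  have : FiniteDimensional ℝ E := b.toBasis.finiteDimensional_of_finite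
  have hN : (0 : ℝ) < Fintype.card X := by exact_mod_cast Fintype.card_pos
  have hv0 : ∀ x j, v x j ≠ 0 := fun x j h0 =>
    hv x (MultilinearMap.map_coord_zero (b.toBasis.det).toMultilinearMap j h0)
  let G : (E ≃ₗ[ℝ] E) → ℝ := fun B =>
    ∑ x, ∑ j, Real.log (‖B (v x j)‖ ^ 2) -
      Fintype.card X * Real.log (LinearMap.det (B : E →ₗ[ℝ] E) ^ 2)
  have hdet : ∀ B : E ≃ₗ[ℝ] E, LinearMap.det (B : E →ₗ[ℝ] E) ≠ 0 := fun B =>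
    (LinearEquiv.isUnit_det' B).ne_zero
  have hbdd : BddBelow (Set.range G) := by
    refine ⟨∑ x, Real.log (b.toBasis.det (v x) ^ 2), ?_⟩
    rintro _ ⟨B, rfl⟩
    have hx : ∀ x, Real.log (b.toBasis.det (v x) ^ 2) +
        Real.log (LinearMap.det (B : E →ₗ[ℝ] E) ^ 2) ≤ ∑ j, Real.log (‖B (v x j)‖ ^ 2) := by
      intro x
      have h := b.abs_det_le_prod_norm (fun j => (B : E →ₗ[ℝ] E) (v x j))
      have h' : b.toBasis.det (fun j => (B : E →ₗ[ℝ] E) (v x j)) =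
          LinearMap.det (B : E →ₗ[ℝ] E) * b.toBasis.det (v x) :=
        Module.Basis.det_comp b.toBasis (B : E →ₗ[ℝ] E) (v x)
      rw [h'] at h
      have hne : ∀ j, ‖B (v x j)‖ ^ 2 ≠ 0 := fun j => by
        simpa using hv0 x j
      rw [← Real.log_prod (fun j _ => hne j), Finset.prod_pow,
        ← Real.log_mul (pow_ne_zero 2 (hv x)) (pow_ne_zero 2 (hdet B)), ← mul_pow, mul_comm,
        ← sq_abs]
      refine Real.log_le_log ?_ (pow_le_pow_left₀ (abs_nonneg _) h 2)
      exact pow_pos (abs_pos.2 (mul_ne_zero (hdet B) (hv x))) 2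
    have := Finset.sum_le_sum fun x (_ : x ∈ Finset.univ) => hx x
    rw [Finset.sum_add_distrib, Finset.sum_const, Finset.card_univ, nsmul_eq_mul] at this
    simp only [G]
    linarith
  have hlog : (1 : ℝ) < Real.log 4 := by
    have := Real.log_two_gt_d9
    rw [show (4 : ℝ) = 2 ^ 2 by norm_num, Real.log_pow]
    push_cast
    linarith
  -- stretching a direction of small second moment would lower the potential by more than this
  obtain ⟨B, hB⟩ : ∃ B, G B < iInf G + Fintype.card X * (Real.log 4 - 3 / 4) :=
    exists_lt_of_ciInf_lt (lt_add_of_pos_right _ (mul_pos hN (by linarith)))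
  refine ⟨B, fun u hu => ?_⟩
  by_contra! hlt
  let T := LinearMap.transvection (innerSL ℝ u : E →ₗ[ℝ] ℝ) u
  have hT : LinearMap.det T = 2 := by
    simp only [T, LinearMap.transvection.det]
    simp [hu]
    norm_num
  let C : E ≃ₗ[ℝ] E := B.trans (LinearEquiv.ofIsUnitDet (f := T) (v := b.toBasis)
    (v' := b.toBasis) (by rw [LinearMap.det_toMatrix, hT]; norm_num))
  have hCa : ∀ w, C w = B w + inner ℝ u (B w) • u := fun w => by
    simp [C, T, LinearMap.transvection.apply]
  have hCdet : LinearMap.det (C : E →ₗ[ℝ] E) = 2 * LinearMap.det (B : E →ₗ[ℝ] E) := by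
    have : (C : E →ₗ[ℝ] E) = T ∘ₗ (B : E →ₗ[ℝ] E) := by
      ext w; simp [C]
    rw [this, LinearMap.det_comp, hT]
  have hGC : G C ≤ G B + 3 * (∑ x, ∑ j, (inner ℝ (B (v x j)) u / ‖B (v x j)‖) ^ 2) -
      Fintype.card X * Real.log 4 := by
    have h1 : ∑ x, ∑ j, Real.log (‖C (v x j)‖ ^ 2) ≤ ∑ x, ∑ j, (Real.log (‖B (v x j)‖ ^ 2) +
        3 * (inner ℝ (B (v x j)) u / ‖B (v x j)‖) ^ 2) := by
      refine Finset.sum_le_sum fun x _ => Finset.sum_le_sum fun j _ => ?_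
      rw [hCa]
      exact log_norm_sq_stretch_le (by simpa using hv0 x j) hu
    simp only [Finset.sum_add_distrib, ← Finset.mul_sum] at h1
    simp only [G]
    rw [hCdet, mul_pow, Real.log_mul (by norm_num) (pow_ne_zero 2 (hdet B))]
    norm_num
    norm_num at h1
    linarith
  have := ciInf_le hbdd C
  linarith

/-! ### Sign rank of Hadamard matrices -/

/-- Lindsey's lemma for vectors: a matrix with orthogonal columns of squared length `N` correlates
weakly with every family of inner products. -/
theorem sq_sum_mul_inner_le {X Y E : Type*} [Fintype X] [Fintype Y] [DecidableEq Y]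
    [NormedAddCommGroup E] [InnerProductSpace ℝ E] (M : X → Y → ℝ) {N : ℝ}
    (hM : ∀ y y', ∑ x, M x y * M x y' = if y = y' then N else 0) (a : X → E) (c : Y → E) :
    (∑ x, ∑ y, M x y * inner ℝ (a x) (c y)) ^ 2 ≤
      (∑ x, ‖a x‖ ^ 2) * (N * ∑ y, ‖c y‖ ^ 2) := by
  have h1 : ∑ x, ‖∑ y, M x y • c y‖ ^ 2 = N * ∑ y, ‖c y‖ ^ 2 := by
    calc ∑ x, ‖∑ y, M x y • c y‖ ^ 2
        = ∑ x, ∑ y, ∑ y', M x y * M x y' * inner ℝ (c y) (c y') := by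
          refine Finset.sum_congr rfl fun x _ => ?_
          rw [← real_inner_self_eq_norm_sq, sum_inner]
          refine Finset.sum_congr rfl fun y _ => ?_
          rw [inner_sum]
          refine Finset.sum_congr rfl fun y' _ => ?_
          rw [inner_smul_left, inner_smul_right]
          simp [mul_assoc]
      _ = ∑ y, ∑ y', (∑ x, M x y * M x y') * inner ℝ (c y) (c y') := by
          rw [Finset.sum_comm]
          refine Finset.sum_congr rfl fun y _ => ?_
          rw [Finset.sum_comm]
          simp_rw [Finset.sum_mul]
      _ = _ := by
          simp [hM, Finset.mul_sum]
  calc (∑ x, ∑ y, M x y * inner ℝ (a x) (c y)) ^ 2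
      = (∑ x, inner ℝ (a x) (∑ y, M x y • c y)) ^ 2 := by
        simp [inner_sum, inner_smul_right]
    _ ≤ (∑ x, ‖a x‖ * ‖∑ y, M x y • c y‖) ^ 2 := by
        rw [sq_le_sq]
        refine (Finset.abs_sum_le_sum_abs _ _).trans ((Finset.sum_le_sum fun x _ =>
          abs_real_inner_le_norm _ _).trans (le_abs_self _))
    _ ≤ (∑ x, ‖a x‖ ^ 2) * ∑ x, ‖∑ y, M x y • c y‖ ^ 2 :=
        Finset.sum_mul_sq_le_sq_mul_sq _ _ _
    _ = _ := by rw [h1]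

/-- The vectors `w + δ eⱼ` form a basis for all small `δ ≠ 0`. -/
theorem eventually_det_add_smul_ne_zero {ι E : Type*} [Fintype ι] [DecidableEq ι]
    [NormedAddCommGroup E] [InnerProductSpace ℝ E] (b : OrthonormalBasis ι ℝ E) (w : E) :
    ∀ᶠ δ : ℝ in 𝓝[≠] 0, b.toBasis.det (fun j => w + δ • b j) ≠ 0 := by
  let A : Matrix ι ι ℝ := Matrix.of fun i _ => -b.repr w i
  have hA : ∀ δ, b.toBasis.det (fun j => w + δ • b j) = A.charpoly.eval δ := fun δ => by
    rw [Matrix.eval_charpoly, Module.Basis.det_apply]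
    congr 1
    ext i j
    simp [Module.Basis.toMatrix_apply, A, Matrix.scalar_apply, Matrix.diagonal_apply,
      add_comm]
  have hfin : {δ | A.charpoly.eval δ = 0}.Finite :=
    Polynomial.finite_setOfPred_isRoot A.charpoly_monic.ne_zero
  have := (hfin.subset Set.sdiff_subset : ({δ | A.charpoly.eval δ = 0} \ {0}).Finite)
  have hopen := this.isClosed.isOpen_compl.mem_nhds (x := (0 : ℝ)) (by simp)
  filter_upwards [mem_nhdsWithin_of_mem_nhds hopen, self_mem_nhdsWithin] with δ h1 h2
  rw [hA]
  intro h
  exact h1 ⟨h, h2⟩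

/-- Forster's lower bound on the sign rank of a Hadamard matrix, up to a constant. -/
theorem card_le_of_sign_representation {X ι E : Type*} [Fintype X] [DecidableEq X] [Fintype ι]
    [NormedAddCommGroup E] [InnerProductSpace ℝ E] (b : OrthonormalBasis ι ℝ E)
    (M : X → X → ℝ) (hM1 : ∀ x y, |M x y| = 1)
    (hM : ∀ y y', ∑ x, M x y * M x y' = if y = y' then (Fintype.card X : ℝ) else 0)
    (φ ψ : X → E) (hsign : ∀ x y, 0 < M x y * inner ℝ (φ x) (ψ y)) :
    Fintype.card X ≤ 16 * Fintype.card ι ^ 2 := by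
  classical
  rcases isEmpty_or_nonempty X with hX | hX
  · simp
  have : FiniteDimensional ℝ E := b.toBasis.finiteDimensional_of_finite
  set N : ℝ := (Fintype.card X : ℝ) with hNdef
  set d : ℝ := (Fintype.card ι : ℝ) with hd
  have hN : 0 < N := by rw [hNdef]; exact_mod_cast Fintype.card_pos
  -- a small perturbation gives bases and keeps all the signs
  obtain ⟨δ, hδdet, hδ⟩ : ∃ δ : ℝ, (∀ x, b.toBasis.det (fun j => φ x + δ • b j) ≠ 0) ∧
      ∀ x y j, 0 < M x y * inner ℝ (φ x + δ • b j) (ψ y) := by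
    have h1 : ∀ᶠ δ : ℝ in 𝓝[≠] 0, ∀ x, b.toBasis.det (fun j => φ x + δ • b j) ≠ 0 :=
      eventually_all.2 fun x => eventually_det_add_smul_ne_zero b (φ x)
    have h2 : ∀ᶠ δ : ℝ in 𝓝 0, ∀ x y j, 0 < M x y * inner ℝ (φ x + δ • b j) (ψ y) := by
      refine eventually_all.2 fun x => eventually_all.2 fun y => eventually_all.2 fun j => ?_
      have hc : Continuous fun δ : ℝ => M x y * inner ℝ (φ x + δ • b j) (ψ y) := by fun_prop
      exact hc.continuousAt.eventually_const_lt (by simpa using hsign x y)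
    exact (h1.and (nhdsWithin_le_nhds h2)).exists
  let v : X → ι → E := fun x j => φ x + δ • b j
  obtain ⟨B, hB⟩ := exists_linearEquiv_nearly_isotropic b v hδdet
  -- the inverse transpose of `B` acts on the other side, so that inner products are kept
  let B' : E →ₗ[ℝ] E := LinearMap.adjoint (B.symm : E →ₗ[ℝ] E)
  have hBB' : ∀ w z, inner ℝ (B w) (B' z) = inner ℝ w z := fun w z => by
    simp [B', LinearMap.adjoint_inner_right]
  have hv0 : ∀ x y j, 0 < M x y * inner ℝ (B (v x j)) (B' (ψ y)) := fun x y j => by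
    rw [hBB']; exact hδ x y j
  let a : X → ι → E := fun x j => ‖B (v x j)‖⁻¹ • B (v x j)
  let c : X → E := fun y => ‖B' (ψ y)‖⁻¹ • B' (ψ y)
  obtain ⟨x₀⟩ := id hX
  have hψ : ∀ y, B' (ψ y) ≠ 0 := fun y h0 => by
    have := hsign x₀ y
    rw [← hBB', h0] at this
    simp at this
  have hc : ∀ y, ‖c y‖ = 1 := fun y => norm_smul_inv_norm (𝕜 := ℝ) (hψ y)
  have ha : ∀ x j, ‖a x j‖ ≤ 1 := fun x j => by
    simp only [a, norm_smul, norm_inv, norm_norm]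
    exact inv_mul_le_one
  have hac : ∀ x y j, inner ℝ (a x j) (c y) = inner ℝ (B (v x j)) (c y) / ‖B (v x j)‖ :=
    fun x y j => by simp only [a, inner_smul_left]; simp; ring
  -- `t ^ 2 ≤ |t|` for the normalized inner products `t`, whose signs are those of `M`
  have hle : ∀ x y j, (inner ℝ (B (v x j)) (c y) / ‖B (v x j)‖) ^ 2 ≤
      M x y * inner ℝ (a x j) (c y) := fun x y j => by
    have h0 : 0 ≤ M x y * inner ℝ (a x j) (c y) := by
      have : M x y * inner ℝ (a x j) (c y) = ‖B (v x j)‖⁻¹ * ‖B' (ψ y)‖⁻¹ *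
          (M x y * inner ℝ (B (v x j)) (B' (ψ y))) := by
        simp only [a, c, inner_smul_left, inner_smul_right]
        simp; ring
      rw [this]
      exact mul_nonneg (by positivity) (hv0 x y j).le
    rw [← abs_of_nonneg h0, abs_mul, hM1, one_mul, hac]
    have h1 := inner_div_norm_sq_le_one (B (v x j)) (hc y)
    rw [← sq_abs] at h1 ⊢
    have h2 := (sq_le_one_iff₀ (abs_nonneg _)).1 h1
    exact pow_le_of_le_one (abs_nonneg _) h2 two_ne_zero
  have hlow : N * (N / 4) ≤ ∑ x, ∑ y, M x y * inner ℝ (∑ j, a x j) (c y) := by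
    calc N * (N / 4) = ∑ _y : X, N / 4 := by simp [hNdef]
      _ ≤ ∑ y, ∑ x, ∑ j, (inner ℝ (B (v x j)) (c y) / ‖B (v x j)‖) ^ 2 :=
        Finset.sum_le_sum fun y _ => hB (c y) (hc y)
      _ ≤ ∑ y, ∑ x, ∑ j, M x y * inner ℝ (a x j) (c y) :=
        Finset.sum_le_sum fun y _ => Finset.sum_le_sum fun x _ => Finset.sum_le_sum fun j _ =>
          hle x y j
      _ = _ := by
        rw [Finset.sum_comm]
        simp [sum_inner, Finset.mul_sum]
  have hup := sq_sum_mul_inner_le M hM (fun x => ∑ j, a x j) c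
  have hnorm : ∑ x, ‖∑ j, a x j‖ ^ 2 ≤ N * d ^ 2 := by
    calc ∑ x, ‖∑ j, a x j‖ ^ 2 ≤ ∑ _x : X, d ^ 2 := by
          refine Finset.sum_le_sum fun x _ => pow_le_pow_left₀ (norm_nonneg _) ?_ 2
          calc ‖∑ j, a x j‖ ≤ ∑ _j : ι, (1 : ℝ) := norm_sum_le_of_le _ fun j _ => ha x j
            _ = d := by simp [hd]
      _ = _ := by simp [hNdef]
  have hcsum : ∑ y, ‖c y‖ ^ 2 = N := by simp [hc, hNdef]
  rw [hcsum] at hup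
  have h1 : (N * (N / 4)) ^ 2 ≤ N * d ^ 2 * (N * N) :=
    (pow_le_pow_left₀ (by positivity) hlow 2).trans
      (hup.trans (mul_le_mul_of_nonneg_right hnorm (by positivity)))
  have h2 : N ≤ 16 * d ^ 2 := by
    have h3 : N ^ 3 * N ≤ N ^ 3 * (16 * d ^ 2) := by linarith
    exact le_of_mul_le_mul_left h3 (by positivity)
  rw [hNdef, hd] at h2
  exact_mod_cast h2

/-! ### The inner product matrix -/

/-- The signs `(-1) ^ b` turn the exclusive or into a product. -/
theorem prod_sign_eq_sign_foldr_xor (l : List Bool) :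
    (l.map fun b => if b = true then (-1 : ℝ) else 1).prod =
      if l.foldr xor false = true then -1 else 1 := by
  induction l with
  | nil => simp
  | cons b l ih =>
    rw [List.map_cons, List.prod_cons, ih, List.foldr_cons]
    cases b <;> cases l.foldr xor false <;> simp

/-- The `±1` matrix of `innerProductMod2`, with the value `1` where the function is true. -/
def innerProductSign (n : ℕ) (x y : Fin n → Bool) : ℝ :=
  if innerProductMod2 n (Sum.elim x y) = true then 1 else -1

theorem abs_innerProductSign (n : ℕ) (x y : Fin n → Bool) : |innerProductSign n x y| = 1 := by
  unfold innerProductSign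
  split_ifs <;> simp

theorem innerProductSign_eq_neg_prod (n : ℕ) (x y : Fin n → Bool) :
    innerProductSign n x y = -∏ i, if (x i && y i) = true then (-1 : ℝ) else 1 := by
  have h := prod_sign_eq_sign_foldr_xor (List.ofFn fun i : Fin n => x i && y i)
  rw [List.map_ofFn, List.prod_ofFn] at h
  simp only [Function.comp_apply] at h
  rw [h]
  have hIP : innerProductMod2 n (Sum.elim x y) =
      (List.ofFn fun i : Fin n => x i && y i).foldr xor false := rfl
  rw [innerProductSign, hIP]
  split_ifs <;> simp

/-- The columns of the inner product matrix are orthogonal: it is a Hadamard matrix. -/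
theorem sum_innerProductSign_mul (n : ℕ) (y y' : Fin n → Bool) :
    ∑ x, innerProductSign n x y * innerProductSign n x y' =
      if y = y' then (Fintype.card (Fin n → Bool) : ℝ) else 0 := by
  let g : Fin n → Bool → ℝ := fun i b =>
    (if (b && y i) = true then (-1 : ℝ) else 1) * if (b && y' i) = true then (-1 : ℝ) else 1
  have h1 : ∑ x, innerProductSign n x y * innerProductSign n x y' = ∏ i, ∑ b, g i b := by
    rw [Fintype.prod_sum]
    simp only [innerProductSign_eq_neg_prod, neg_mul_neg, ← Finset.prod_mul_distrib, g]
  have h2 : ∀ i, ∑ b, g i b = if y i = y' i then 2 else 0 := fun i => by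
    simp only [g, Fintype.sum_bool]
    cases y i <;> cases y' i <;> norm_num
  rw [h1]
  simp only [h2]
  split_ifs with h
  · simp [h]
  · obtain ⟨i, hi⟩ := Function.ne_iff.1 h
    exact Finset.prod_eq_zero (Finset.mem_univ i) (if_neg hi)

/-! ### Sign representations from nearest neighbors -/

/-- The set of the `k` nearest prototypes is the unique minimizer, among all `k`-element sets of
prototypes, of the sum of the squared distances. -/
theorem IsKNearest.sum_dist_sq_lt {E : Type*} [MetricSpace E] {k : ℕ} {Q : Finset E} {a : E}
    {S T : Finset E} (hS : IsKNearest k Q a S) (hTQ : T ⊆ Q) (hT : T.card = k) (hne : T ≠ S) :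
    ∑ p ∈ S, dist a p ^ 2 < ∑ p ∈ T, dist a p ^ 2 := by
  classical
  obtain ⟨-, hSk, hlt⟩ := hS
  have hcard : (S \ T).card = (T \ S).card := Finset.card_sdiff_comm (hSk.trans hT.symm)
  have hnonempty : (S \ T).Nonempty := by
    rw [Finset.sdiff_nonempty]
    intro hsub
    exact hne (Finset.eq_of_subset_of_card_le hsub (hT.trans hSk.symm).le).symm
  rw [← Finset.sum_inter_add_sum_sdiff S T, ← Finset.sum_inter_add_sum_sdiff T S,
    Finset.inter_comm T S]
  refine add_lt_add_right ?_ _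
  let e := Finset.equivOfCardEq hcard
  have := hnonempty.to_subtype
  rw [← Finset.sum_coe_sort (S \ T), ← Finset.sum_coe_sort (T \ S),
    ← e.sum_comp fun q => dist a (q : E) ^ 2]
  refine Finset.sum_lt_sum_of_nonempty Finset.univ_nonempty fun p _ => ?_
  have hp := Finset.mem_sdiff.1 p.2
  have hq := Finset.mem_sdiff.1 (e p).2
  exact pow_lt_pow_left₀ (hlt p hp.1 _ (hTQ hq.1) hq.2) dist_nonneg two_ne_zero

/-- In a sum of exponentials with decay rates `D t`, the term with the least rate decides the
sign. -/
theorem eventually_sign_sum_exp {τ : Type*} [Fintype τ] (D s : τ → ℝ) (t₀ : τ)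
    (hD : ∀ t, t ≠ t₀ → D t₀ < D t) (hs : s t₀ ≠ 0) :
    ∀ᶠ β : ℝ in atTop, 0 < s t₀ * ∑ t, s t * Real.exp (-(β * D t)) := by
  classical
  have h1 : Tendsto (fun β : ℝ => s t₀ * ∑ t, s t * Real.exp (-(β * (D t - D t₀)))) atTop
      (𝓝 (s t₀ * ∑ t, if t = t₀ then s t₀ else 0)) := by
    refine (tendsto_finsetSum _ fun t _ => ?_).const_mul _
    split_ifs with h
    · subst h
      simp
    · have := (Real.tendsto_exp_neg_atTop_nhds_zero.comp
        (tendsto_id.atTop_mul_const (sub_pos.2 (hD t h)))).const_mul (s t)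
      simpa using this
  have h2 : 0 < s t₀ * ∑ t, if t = t₀ then s t₀ else 0 := by
    simpa using mul_self_pos.2 hs
  filter_upwards [h1.eventually_const_lt h2] with β hβ
  have h3 : s t₀ * ∑ t, s t * Real.exp (-(β * D t)) = Real.exp (-(β * D t₀)) *
      (s t₀ * ∑ t, s t * Real.exp (-(β * (D t - D t₀)))) := by
    rw [mul_left_comm, Finset.mul_sum (a := Real.exp _)]
    congr 1
    refine Finset.sum_congr rfl fun t _ => ?_
    rw [mul_left_comm, ← Real.exp_add]
    ring_nf
  rw [h3]
  exact mul_pos (Real.exp_pos _) hβ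

theorem dist_cubePoint_sumElim_sq {ι κ : Type*} [Fintype ι] [Fintype κ] (x : ι → Bool)
    (y : κ → Bool) (p : EuclideanSpace ℝ (ι ⊕ κ)) :
    dist (cubePoint (Sum.elim x y)) p ^ 2 =
      ∑ i, ((if x i = true then (1 : ℝ) else 0) - p (Sum.inl i)) ^ 2 +
        ∑ j, ((if y j = true then (1 : ℝ) else 0) - p (Sum.inr j)) ^ 2 := by
  rw [EuclideanSpace.dist_eq, Real.sq_sqrt (Finset.sum_nonneg fun _ _ => sq_nonneg _),
    Fintype.sum_sum_type]
  simp only [cubePoint, Real.dist_eq, sq_abs]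
  rfl

/-- A `k`-nearest neighbor representation with prototype set `Q` yields a sign representation
whose dimension is the number of `k`-element subsets of `Q`. That `Q` is the union of `P`
and `N` is stated through membership, which keeps the statement free of a choice of decidable equality. -/
theorem IsKNNRepresentation.exists_sign_representation {ι κ : Type*} [Fintype ι] [Fintype κ]
    {k : ℕ} {f : (ι ⊕ κ → Bool) → Bool} {P N : Finset (EuclideanSpace ℝ (ι ⊕ κ))}
    {Q : Finset (EuclideanSpace ℝ (ι ⊕ κ))} (hQ : ∀ p, p ∈ Q ↔ p ∈ P ∨ p ∈ N)
    (h : IsKNNRepresentation k f P N) :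
    ∃ (φ : (ι → Bool) → EuclideanSpace ℝ (Q.powersetCard k))
      (ψ : (κ → Bool) → EuclideanSpace ℝ (Q.powersetCard k)),
      ∀ x y, 0 < (if f (Sum.elim x y) = true then (1 : ℝ) else -1) * inner ℝ (φ x) (ψ y) := by
  classical
  have hQ' : P ∪ N = Q := by ext p; simp [hQ]
  let s : Q.powersetCard k → ℝ := fun T => if (k : ℝ) / 2 ≤ ((T.1 ∩ P).card : ℝ) then 1 else -1
  let D : (ι ⊕ κ → Bool) → Q.powersetCard k → ℝ := fun a T =>
    ∑ p ∈ T.1, dist (cubePoint a) p ^ 2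
  have hev : ∀ a, ∀ᶠ β : ℝ in atTop,
      0 < (if f a = true then (1 : ℝ) else -1) * ∑ T, s T * Real.exp (-(β * D a T)) := by
    intro a
    obtain ⟨S, hS, hfS⟩ := h.2 a
    have hSQ : S ∈ Q.powersetCard k := Finset.mem_powersetCard.2 ⟨by
      rw [← hQ']; convert hS.1, hS.2.1⟩
    have hSQ' : IsKNearest k Q (cubePoint a) S := by rw [← hQ']; convert hS
    have hs : s ⟨S, hSQ⟩ = if f a = true then (1 : ℝ) else -1 := by
      simp only [s]
      refine if_congr ?_ rfl rfl
      rw [hfS]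
    rw [← hs]
    refine eventually_sign_sum_exp (D a) s ⟨S, hSQ⟩ (fun T hT => ?_) ?_
    · have hTQ := Finset.mem_powersetCard.1 T.2
      exact hSQ'.sum_dist_sq_lt hTQ.1 hTQ.2 fun h => hT (Subtype.ext h)
    · rw [hs]
      split_ifs <;> norm_num
  obtain ⟨β, hβ⟩ := (eventually_all.2 hev).exists
  refine ⟨fun x => WithLp.toLp 2 fun T => Real.exp (-(β * ∑ p ∈ T.1,
      ∑ i, ((if x i = true then (1 : ℝ) else 0) - p (Sum.inl i)) ^ 2)),
    fun y => WithLp.toLp 2 fun T => s T * Real.exp (-(β * ∑ p ∈ T.1,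
      ∑ j, ((if y j = true then (1 : ℝ) else 0) - p (Sum.inr j)) ^ 2)), fun x y => ?_⟩
  have h1 := hβ (Sum.elim x y)
  convert h1 using 2
  rw [PiLp.inner_apply]
  refine Finset.sum_congr rfl fun T _ => ?_
  simp only [D, dist_cubePoint_sumElim_sq, Finset.sum_add_distrib, mul_add, neg_add, Real.exp_add]
  simp
  ring

/-! ### Existence of nearest neighbor representations -/

theorem one_le_dist_cubePoint {ι : Type*} [Fintype ι] {a a' : ι → Bool} (h : a ≠ a') :
    1 ≤ dist (cubePoint a) (cubePoint a') := by
  obtain ⟨i, hi⟩ := Function.ne_iff.1 h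
  rw [dist_eq_norm]
  refine le_trans ?_ (PiLp.norm_apply_le (cubePoint a - cubePoint a') i)
  simp only [cubePoint, PiLp.sub_apply]
  cases ha : a i <;> cases ha' : a' i <;> simp_all

/-- Clusters of `k` prototypes around the vertices represent every Boolean function. -/
theorem exists_isKNNRepresentation {ι : Type*} [Fintype ι] [Nonempty ι] {k : ℕ} (hk : 1 ≤ k)
    (f : (ι → Bool) → Bool) : ∃ P N, IsKNNRepresentation k f P N := by
  classical
  have hC : ∀ a : ι → Bool, ∃ C : Finset (EuclideanSpace ℝ ι),
      (C : Set (EuclideanSpace ℝ ι)) ⊆ Metric.ball (cubePoint a) (1 / 4) ∧ C.card = k := fun a =>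
    (infinite_of_mem_nhds (cubePoint a)
      (Metric.ball_mem_nhds _ (by norm_num))).exists_subset_card_eq k
  choose C hCball hCcard using hC
  have hnear : ∀ a, ∀ p ∈ C a, dist (cubePoint a) p < 1 / 4 := fun a p hp => by
    rw [dist_comm]; exact hCball a hp
  have hfar : ∀ a a', a ≠ a' → ∀ p ∈ C a', 3 / 4 < dist (cubePoint a) p := fun a a' h p hp => by
    have h1 := one_le_dist_cubePoint h
    have h2 := dist_triangle_right (cubePoint a) (cubePoint a') p
    have h3 := hnear a' p hp
    linarith
  have heq : ∀ a a' p, p ∈ C a → p ∈ C a' → a = a' := fun a a' p hp hp' => by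
    by_contra h
    have h1 := hfar a a' h p hp'
    have h2 := hnear a p hp
    linarith
  refine ⟨(Finset.univ.filter fun a => f a = true).biUnion C,
    (Finset.univ.filter fun a => f a = false).biUnion C, ?_, fun a => ⟨C a, ⟨?_, hCcard a, ?_⟩, ?_⟩⟩
  · rw [Finset.disjoint_left]
    intro p hp hp'
    simp only [Finset.mem_biUnion, Finset.mem_filter, Finset.mem_univ, true_and] at hp hp'
    obtain ⟨a, ha, hpa⟩ := hp
    obtain ⟨a', ha', hpa'⟩ := hp'
    rw [heq a a' p hpa hpa', ha'] at ha
    exact Bool.false_ne_true ha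
  · intro p hp
    simp only [Finset.mem_union, Finset.mem_biUnion, Finset.mem_filter, Finset.mem_univ, true_and]
    cases ha : f a
    · exact Or.inr ⟨a, ha, hp⟩
    · exact Or.inl ⟨a, ha, hp⟩
  · intro p hp q hq hqa
    have : ∃ a', q ∈ C a' := by
      simp only [Finset.mem_union, Finset.mem_biUnion] at hq
      rcases hq with ⟨a', -, h⟩ | ⟨a', -, h⟩ <;> exact ⟨a', h⟩
    obtain ⟨a', ha'⟩ := this
    have h1 := hfar a a' (fun h => hqa (h ▸ ha')) q ha'
    have h2 := hnear a p hp
    linarith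
  · cases ha : f a
    · have h0 : C a ∩ (Finset.univ.filter fun a => f a = true).biUnion C = ∅ := by
        rw [← Finset.disjoint_iff_inter_eq_empty, Finset.disjoint_left]
        intro p hp hp'
        simp only [Finset.mem_biUnion, Finset.mem_filter, Finset.mem_univ, true_and] at hp'
        obtain ⟨a', ha', hpa'⟩ := hp'
        rw [← heq a a' p hp hpa', ha] at ha'
        exact Bool.false_ne_true ha'
      have hk' : (0 : ℝ) < k := by exact_mod_cast hk
      have hneg : ¬ (k : ℝ) / 2 ≤ ((∅ : Finset (EuclideanSpace ℝ ι)).card : ℝ) := by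
        simp only [Finset.card_empty, Nat.cast_zero, not_le]
        linarith
      simp only [Bool.false_eq_true, false_iff]
      convert hneg
    · have h1 : C a ∩ (Finset.univ.filter fun a => f a = true).biUnion C = C a :=
        Finset.inter_eq_left.2 (Finset.subset_biUnion_of_mem C (by simp [ha]))
      have hpos : (k : ℝ) / 2 ≤ ((C a).card : ℝ) := by
        rw [hCcard]
        exact half_le_self (Nat.cast_nonneg k)
      simp only [true_iff]
      convert hpos

/-! ### The lower bound -/

/-- The sign rank bounds give `n ≤ 2 * m + 4` for `m` prototypes, and `m ≥ k ≥ 1` absorbs the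
constant. -/
theorem IsKNNRepresentation.le_six_mul_card {k n : ℕ} (hk : 1 ≤ k)
    {P N Q : Finset (EuclideanSpace ℝ (Fin n ⊕ Fin n))} (hQ : ∀ p, p ∈ Q ↔ p ∈ P ∨ p ∈ N)
    (h : IsKNNRepresentation k (innerProductMod2 n) P N) : n ≤ 6 * Q.card := by
  obtain ⟨S, hS, -⟩ := h.2 fun _ => false
  have hkQ : k ≤ Q.card := by
    rw [← hS.2.1]
    refine Finset.card_le_card fun p hp => (hQ p).2 ?_
    simpa using hS.1 hp
  obtain ⟨φ, ψ, hsign⟩ := h.exists_sign_representation hQ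
  have h1 := card_le_of_sign_representation (EuclideanSpace.basisFun (Q.powersetCard k) ℝ)
    (innerProductSign n) (abs_innerProductSign n) (sum_innerProductSign_mul n) φ ψ hsign
  have h2 : Fintype.card (Q.powersetCard k) ≤ 2 ^ Q.card := by
    rw [Fintype.card_coe, Finset.card_powersetCard]
    exact Nat.choose_le_two_pow _ _
  have h3 : 2 ^ n ≤ 2 ^ (2 * Q.card + 4) := by
    calc 2 ^ n = Fintype.card (Fin n → Bool) := by simp
      _ ≤ 16 * Fintype.card (Q.powersetCard k) ^ 2 := h1
      _ ≤ 16 * (2 ^ Q.card) ^ 2 := by gcongr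
      _ = 2 ^ (2 * Q.card + 4) := by ring
  have h4 := (Nat.pow_le_pow_iff_right (by norm_num)).1 h3
  omega

theorem mainTheorem2 :
    ∃ ε : ℕ → ℝ, (∀ n, 0 ≤ ε n) ∧ Tendsto ε atTop (𝓝 0) ∧
      ∀ k : ℕ, 1 ≤ k → ∀ n : ℕ,
        (n : ℝ) / (6 + ε n) ≤ (kNNComplexity k (innerProductMod2 n) : ℝ) := by
  classical
  -- the bound `2 ^ n ≤ 16 * 4 ^ m` is strong enough to do without an error term
  refine ⟨fun _ => 0, fun _ => le_rfl, tendsto_const_nhds, fun k hk n => ?_⟩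
  rcases Nat.eq_zero_or_pos n with rfl | hn
  · simp
  have : Nonempty (Fin n ⊕ Fin n) := ⟨Sum.inl ⟨0, hn⟩⟩
  obtain ⟨P₀, N₀, h₀⟩ := exists_isKNNRepresentation hk (innerProductMod2 n)
  obtain ⟨P, N, h, hcard⟩ := Nat.sInf_mem (s := {m : ℕ | ∃ P N,
    IsKNNRepresentation k (innerProductMod2 n) P N ∧ (P ∪ N).card = m}) ⟨_, P₀, N₀, h₀, rfl⟩
  have h1 : n ≤ 6 * (P ∪ N).card := h.le_six_mul_card hk fun p => Finset.mem_union
  have h2 : (P ∪ N).card = kNNComplexity k (innerProductMod2 n) := by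
    rw [hcard]
    unfold kNNComplexity
    congr!
  rw [h2] at h1
  rw [add_zero, div_le_iff₀' (by norm_num)]
  exact_mod_cast h1
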